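/- Let $D \ge 1$ be an integer and let $G$ be a finite simple graph with $n > D$ vertices. Call $G$ *$k$-connected* if it has more than $k$ vertices and remains connected after the deletion of any fewer than $k$ vertices. A *complex orthogonal representation* (COR) of $G$ in $\mathbb{C}^D$ is a family $(v_i)$ of vectors of $\mathbb{C}^D$, indexed by the vertices of $G$, such that $\sum_{\ell=1}^{D} (v_i)_\ell (v_j)_\ell = 0$ (no conjugation) for all distinct non-adjacent vertices $i, j$. It is a *general position complex orthogonal representation* (CGOR) if, moreover, the vectors at any set of at most $D$ vertices are linearly independent. A subset of $\mathbb{C}^N$ is *algebraic* if it is defined by finitely many polynomial equations; it is a *quasi-projective variety* if it is the difference $Z \setminus W$ of two algebraic sets; and it is *irreducible* if it is non-empty and its Zariski closure (the smallest algebraic set containing it) is not the union of two proper algebraic subsets. 1. If $G$ is $(n-D)$-connected, then the set of CGORs of $G$ in $\mathbb{C}^D$, as a subset of $\mathbb{C}^{nD}$, is non-empty and is an irreducible quasi-projective variety. 2. If $G$ is not $(n-D)$-connected, then $G$ has no CGOR in $\mathbb{C}^D$, and $G$ has no COR in $\mathbb{C}^D$ such that, for every vertex $i$, the vectors at the vertices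 different from $i$ and not adjacent to $i$ form a linearly independent family. -/

import Mathlib

namespace OrthRep

/-! ### Algebraic sets, quasi-projective sets and irreducibility in `ℂ^σ` -/

/-- A subset of `ℂ^σ` cut out by finitely many polynomial equations. -/
def IsAlgebraicSet {σ : Type*} (Z : Set (σ → ℂ)) : Prop :=
  ∃ F : Finset (MvPolynomial σ ℂ), Z = {x | ∀ p ∈ F, MvPolynomial.eval x p = 0}

/-- A Zariski open subset of an algebraic set. -/
def IsQuasiProjective {σ : Type*} (S : Set (σ → ℂ)) : Prop :=
  ∃ Z W : Set (σ → ℂ), IsAlgebraicSet Z ∧ IsAlgebraicSet W ∧ S = Z \ W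

/-- The smallest algebraic set that contains `S`. -/
def zariskiClosure {σ : Type*} (S : Set (σ → ℂ)) : Set (σ → ℂ) :=
  ⋂₀ {Z | IsAlgebraicSet Z ∧ S ⊆ Z}

/-- A non-empty set whose Zariski closure is not the union of two proper algebraic subsets. -/
def IsIrreducibleSet {σ : Type*} (S : Set (σ → ℂ)) : Prop :=
  S.Nonempty ∧ ¬ ∃ A B : Set (σ → ℂ), IsAlgebraicSet A ∧ IsAlgebraicSet B ∧
    A ⊂ zariskiClosure S ∧ B ⊂ zariskiClosure S ∧ zariskiClosure S = A ∪ B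

/-! ### Vertex connectivity -/

/-- `G` has more than `k` vertices, and it remains connected whenever fewer than `k` vertices are
deleted. -/
def IsKConnected {V : Type*} [Fintype V] (G : SimpleGraph V) (k : ℕ) : Prop :=
  k < Fintype.card V ∧ ∀ S : Finset V, S.card < k → (G.induce {v | v ∉ S}).Connected

/-! ### Complex orthogonal representations -/

/-- Distinct non-adjacent vertices get vectors whose dot product, taken without conjugation,
is zero. -/
def IsCOR {V : Type*} (G : SimpleGraph V) {D : ℕ} (v : V → Fin D → ℂ) : Prop :=
  ∀ i j : V, i ≠ j → ¬ G.Adj i j → ∑ k, v i k * v j k = 0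

/-- Any at most `D` of the vectors in `ℂ^D` are linearly independent. -/
def InGeneralPosition {V : Type*} {D : ℕ} (v : V → Fin D → ℂ) : Prop :=
  ∀ T : Finset V, T.card ≤ D → LinearIndependent ℂ (fun i : T => v i)

/-- A general position complex orthogonal representation. -/
def IsCGOR {V : Type*} (G : SimpleGraph V) {D : ℕ} (v : V → Fin D → ℂ) : Prop :=
  IsCOR G v ∧ InGeneralPosition v

/-- For every vertex `i`, the family of vectors at the non-neighbours of `i`
(other than `i` itself) is linearly independent. -/
def NonNeighborsIndependent {V : Type*} (G : SimpleGraph V) {D : ℕ} (v : V → Fin D → ℂ) : Prop :=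
  ∀ i : V, LinearIndependent ℂ (fun j : {j : V // j ≠ i ∧ ¬ G.Adj i j} => v j)

/-- The set of all CGORs of `G` in `ℂ^D`, as a subset of the affine space `ℂ^(V × D)` of all
vector configurations. -/
def cgorSet {V : Type*} (G : SimpleGraph V) (D : ℕ) : Set (V × Fin D → ℂ) :=
  {x | IsCGOR G (fun i k => x (i, k))}

end OrthRep

/-!
For the negative part, let `A` and `B` be the two sides of a separation of `G` by fewer than `n - D`
vertices. In a representation with independent non-neighbours, the vectors at `A` and those at `B`
are two independent, mutually orthogonal families, and non-degeneracy of the dot product gives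
`|A| + |B| ≤ D` (`card_add_card_le_of_orthogonal`), a contradiction. Representations in general
position have independent non-neighbours.

For the positive part, the set of general position representations of an induced subgraph `G[S]` is
shown to be irreducible by induction on `S` (`isPolyIrreducible_partialCgorSet`). Since the
non-neighbours of a vertex `b` carry independent vectors, the vectors allowed at `b` form a vector
bundle over the representations of `G[S \ {b}]` that are in general position; a polynomial local
section through any given point comes from `exists_orthogonal_section`. Hence the set
`lastVertexSet` of representations of `G[S]` in general position away from `b` is irreducible
(`isPolyIrreducible_extension`), and those in general position form an open subset of it. What
remains is that this open subset is not empty.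

If `|S| ≤ D`, standard basis vectors do. If `|S| > D`, then `G[S]` is connected, because fewer than
`n - D` vertices are missing. For adjacent `a` and `b` the vectors at `a` and `b` can be chosen
independently of each other, so the sets with last vertex `a` and with last vertex `b` meet
(`exists_gpOn_both`) in an open subset of both and therefore have the same closure. By connectivity
all these closures are one irreducible set. For each `T ⊆ S` with `|T| ≤ D` there is a vertex
`b ∈ S \ T`, and the vectors at `T` are independent on the set with last vertex `b`. So independence
of the vectors at `T` is a non-empty open condition on the common closure for every `T`, and by
irreducibility these finitely many conditions hold simultaneously at some point.

Irreducibility is handled through `IsPolyIrreducible`: two polynomial functions that do not vanish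
identically on the set have a common point of non-vanishing in it.
-/

namespace OrthRep

/-! ### Polynomial functions and irreducibility -/

section Polynomial

variable {σ : Type*}

/-- A complex-valued function on `ℂ^σ` given by a polynomial. -/
def IsPolyFun (f : (σ → ℂ) → ℂ) : Prop :=
  ∃ p : MvPolynomial σ ℂ, ∀ x, MvPolynomial.eval x p = f x

/-- Irreducibility of a set `U ⊆ ℂ^σ` in the form used for density arguments: `U` is non-empty, and
any two polynomial functions, neither of which vanishes identically on `U`, are simultaneously
nonzero at some point of `U`. Equivalently, `U` is irreducible in the Zariski topology. -/
def IsPolyIrreducible (U : Set (σ → ℂ)) : Prop :=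
  U.Nonempty ∧ ∀ f g : (σ → ℂ) → ℂ, IsPolyFun f → IsPolyFun g →
    (∃ x ∈ U, f x ≠ 0) → (∃ x ∈ U, g x ≠ 0) → ∃ x ∈ U, f x ≠ 0 ∧ g x ≠ 0

namespace IsPolyFun

theorem const (c : ℂ) : IsPolyFun (fun _ : σ → ℂ => c) :=
  ⟨MvPolynomial.C c, fun x => by simp⟩

theorem coord (s : σ) : IsPolyFun (fun x : σ → ℂ => x s) :=
  ⟨MvPolynomial.X s, fun x => by simp⟩

theorem add {f g : (σ → ℂ) → ℂ} (hf : IsPolyFun f) (hg : IsPolyFun g) :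
    IsPolyFun (fun x => f x + g x) := by
  obtain ⟨p, hp⟩ := hf
  obtain ⟨q, hq⟩ := hg
  exact ⟨p + q, fun x => by simp [hp, hq]⟩

theorem mul {f g : (σ → ℂ) → ℂ} (hf : IsPolyFun f) (hg : IsPolyFun g) :
    IsPolyFun (fun x => f x * g x) := by
  obtain ⟨p, hp⟩ := hf
  obtain ⟨q, hq⟩ := hg
  exact ⟨p * q, fun x => by simp [hp, hq]⟩

theorem sub {f g : (σ → ℂ) → ℂ} (hf : IsPolyFun f) (hg : IsPolyFun g) :
    IsPolyFun (fun x => f x - g x) := by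
  obtain ⟨p, hp⟩ := hf
  obtain ⟨q, hq⟩ := hg
  exact ⟨p - q, fun x => by simp [hp, hq]⟩

theorem sum {ι : Type*} (s : Finset ι) {f : ι → (σ → ℂ) → ℂ} (hf : ∀ i ∈ s, IsPolyFun (f i)) :
    IsPolyFun (fun x => ∑ i ∈ s, f i x) := by
  choose! p hp using hf
  exact ⟨∑ i ∈ s, p i, fun x => by
    rw [map_sum]; exact Finset.sum_congr rfl fun i hi => hp i hi x⟩

theorem prod {ι : Type*} (s : Finset ι) {f : ι → (σ → ℂ) → ℂ} (hf : ∀ i ∈ s, IsPolyFun (f i)) :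
    IsPolyFun (fun x => ∏ i ∈ s, f i x) := by
  choose! p hp using hf
  exact ⟨∏ i ∈ s, p i, fun x => by
    rw [map_prod]; exact Finset.prod_congr rfl fun i hi => hp i hi x⟩

theorem comp {τ : Type*} {f : (σ → ℂ) → ℂ} (hf : IsPolyFun f) {F : (τ → ℂ) → σ → ℂ}
    (hF : ∀ s, IsPolyFun (fun x => F x s)) : IsPolyFun (fun x => f (F x)) := by
  obtain ⟨p, hp⟩ := hf
  choose q hq using hF
  refine ⟨MvPolynomial.bind₁ q p, fun x => ?_⟩
  have h : (fun s => MvPolynomial.eval x (q s)) = F x := funext fun s => hq s x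
  change MvPolynomial.eval x (MvPolynomial.bind₁ q p) = f (F x)
  rw [← hp, ← h, ← MvPolynomial.coe_aeval_eq_eval, ← MvPolynomial.coe_aeval_eq_eval]
  exact MvPolynomial.aeval_bind₁ _ _ _

theorem det {ι : Type*} [Fintype ι] [DecidableEq ι] {M : (σ → ℂ) → Matrix ι ι ℂ}
    (hM : ∀ i j, IsPolyFun (fun x => M x i j)) : IsPolyFun (fun x => (M x).det) := by
  simp only [Matrix.det_apply']
  exact sum _ fun τ _ => (const _).mul (prod _ fun i _ => hM _ _)

theorem adjugate {ι : Type*} [Fintype ι] [DecidableEq ι] {M : (σ → ℂ) → Matrix ι ι ℂ}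
    (hM : ∀ i j, IsPolyFun (fun x => M x i j)) (i j : ι) :
    IsPolyFun (fun x => (M x).adjugate i j) := by
  simp only [Matrix.adjugate_apply]
  refine det fun k l => ?_
  by_cases h : k = j
  · simpa [Matrix.updateRow_apply, h] using const _
  · simpa [Matrix.updateRow_apply, h] using hM k l

/-- On an affine line, a polynomial function is a polynomial in the parameter, so two polynomial
functions that are each nonzero at some point of the line have a common point of non-vanishing. -/
theorem exists_line_ne_zero {f g : (σ → ℂ) → ℂ} (hf : IsPolyFun f) (hg : IsPolyFun g)
    {x y : σ → ℂ} (hx : f x ≠ 0) (hy : g y ≠ 0) :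
    ∃ t : ℂ, f (fun s => x s + t * (y s - x s)) ≠ 0 ∧ g (fun s => x s + t * (y s - x s)) ≠ 0 := by
  obtain ⟨p, hp⟩ := hf
  obtain ⟨q, hq⟩ := hg
  let ℓ : σ → Polynomial ℂ := fun s =>
    Polynomial.C (x s) + Polynomial.X * Polynomial.C (y s - x s)
  have key : ∀ (r : MvPolynomial σ ℂ) (t : ℂ), (MvPolynomial.aeval ℓ r).eval t =
      MvPolynomial.eval (fun s => x s + t * (y s - x s)) r := by
    intro r t
    induction r using MvPolynomial.induction_on with
    | C a => simp
    | add a b ha hb => simp [ha, hb]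
    | mul_X a s ha => rw [map_mul, MvPolynomial.aeval_X, Polynomial.eval_mul, ha, map_mul]; simp [ℓ]
  have h1 : MvPolynomial.aeval ℓ p ≠ 0 := by
    intro h
    have := key p 0
    rw [h] at this
    simp [hp] at this
    exact hx this.symm
  have h2 : MvPolynomial.aeval ℓ q ≠ 0 := by
    intro h
    have := key q 1
    rw [h] at this
    simp [hq] at this
    exact hy this.symm
  have h3 := mul_ne_zero h1 h2
  by_contra! hcon
  refine h3 (Polynomial.funext fun t => ?_)
  have h4 := hcon t
  rw [← hp, ← hq, ← key, ← key] at h4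
  by_cases h5 : (MvPolynomial.aeval ℓ p).eval t = 0
  · simp [h5]
  · simp [h4 h5]

end IsPolyFun

namespace IsPolyIrreducible

theorem univ : IsPolyIrreducible (Set.univ : Set (σ → ℂ)) := by
  refine ⟨⟨0, trivial⟩, ?_⟩
  rintro f g hf hg ⟨x, -, hx⟩ ⟨y, -, hy⟩
  obtain ⟨t, ht⟩ := hf.exists_line_ne_zero hg hx hy
  exact ⟨_, trivial, ht⟩

theorem exists_forall_ne_zero {U : Set (σ → ℂ)} (hU : IsPolyIrreducible U) {ι : Type*}
    (s : Finset ι) {f : ι → (σ → ℂ) → ℂ} (hf : ∀ i ∈ s, IsPolyFun (f i))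
    (hne : ∀ i ∈ s, ∃ x ∈ U, f i x ≠ 0) : ∃ x ∈ U, ∀ i ∈ s, f i x ≠ 0 := by
  classical
  induction s using Finset.induction_on with
  | empty => exact ⟨hU.1.some, hU.1.some_mem, by simp⟩
  | insert a s ha ih =>
    obtain ⟨y, hy, hys⟩ := ih (fun i hi => hf i (Finset.mem_insert_of_mem hi))
      (fun i hi => hne i (Finset.mem_insert_of_mem hi))
    obtain ⟨x, hx, hx1, hx2⟩ := hU.2 (f a) (fun x => ∏ i ∈ s, f i x)
      (hf a (Finset.mem_insert_self a s))
      (IsPolyFun.prod s fun i hi => hf i (Finset.mem_insert_of_mem hi))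
      (hne a (Finset.mem_insert_self a s)) ⟨y, hy, Finset.prod_ne_zero_iff.mpr hys⟩
    refine ⟨x, hx, fun i hi => ?_⟩
    rcases Finset.mem_insert.mp hi with rfl | hi
    · exact hx1
    · exact Finset.prod_ne_zero_iff.mp hx2 i hi

/-- A non-empty relatively Zariski open subset of an irreducible set is irreducible. -/
theorem of_isOpen {U W : Set (σ → ℂ)} (hU : IsPolyIrreducible U) (hWU : W ⊆ U)
    (hW : W.Nonempty)
    (hopen : ∀ x ∈ W, ∃ δ, IsPolyFun δ ∧ δ x ≠ 0 ∧ ∀ z ∈ U, δ z ≠ 0 → z ∈ W) :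
    IsPolyIrreducible W := by
  refine ⟨hW, ?_⟩
  rintro f g hf hg ⟨x, hx, hfx⟩ ⟨y, hy, hgy⟩
  obtain ⟨δ, hδ, hδx, hδW⟩ := hopen x hx
  obtain ⟨z, hz, h1, h2⟩ := hU.2 (fun z => f z * δ z) g (hf.mul hδ) hg
    ⟨x, hWU hx, mul_ne_zero hfx hδx⟩ ⟨y, hWU hy, hgy⟩
  exact ⟨z, hδW z hz (right_ne_zero_of_mul h1), left_ne_zero_of_mul h1, h2⟩

theorem isIrreducibleSet {U : Set (σ → ℂ)} (hU : IsPolyIrreducible U) : IsIrreducibleSet U := by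
  refine ⟨hU.1, ?_⟩
  rintro ⟨A, B, hA, hB, hAc, hBc, hAB⟩
  have hsub : U ⊆ zariskiClosure U := Set.subset_sInter fun Z hZ => hZ.2
  -- A proper algebraic subset of the closure cannot contain `U`.
  have key : ∀ A : Set (σ → ℂ), IsAlgebraicSet A → A ⊂ zariskiClosure U →
      ∃ f, IsPolyFun f ∧ (∃ x ∈ U, f x ≠ 0) ∧ ∀ z ∈ A, f z = 0 := by
    rintro A ⟨F, rfl⟩ hAc
    by_contra! hcon
    refine hAc.2 (Set.sInter_subset_of_mem ⟨⟨F, rfl⟩, fun x hx p hp => ?_⟩)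
    by_contra hne
    obtain ⟨z, hz, hz'⟩ := hcon (fun x => MvPolynomial.eval x p) ⟨p, fun _ => rfl⟩ ⟨x, hx, hne⟩
    exact hz' (hz p hp)
  obtain ⟨f, hf, hfU, hfA⟩ := key A hA hAc
  obtain ⟨g, hg, hgU, hgB⟩ := key B hB hBc
  obtain ⟨x, hx, h1, h2⟩ := hU.2 f g hf hg hfU hgU
  rcases hAB ▸ hsub hx with h | h
  · exact h1 (hfA x h)
  · exact h2 (hgB x h)

end IsPolyIrreducible

/-- A set with Zariski open complement is algebraic, by the Hilbert basis theorem. -/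
theorem isAlgebraicSet_of_isOpen_compl [Finite σ] {N : Set (σ → ℂ)}
    (hN : ∀ x ∉ N, ∃ δ, IsPolyFun δ ∧ δ x ≠ 0 ∧ ∀ z ∈ N, δ z = 0) : IsAlgebraicSet N := by
  obtain ⟨F, hF⟩ := (isNoetherianRing_iff_ideal_fg (MvPolynomial σ ℂ)).mp inferInstance
    (MvPolynomial.vanishingIdeal ℂ N)
  refine ⟨F, Set.Subset.antisymm (fun x hx p hp => ?_) fun x hx => ?_⟩
  · have : p ∈ MvPolynomial.vanishingIdeal ℂ N := hF ▸ Ideal.subset_span hp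
    simpa using MvPolynomial.mem_vanishingIdeal_iff.mp this x hx
  · by_contra hxN
    obtain ⟨δ, ⟨p, hp⟩, hδx, hδN⟩ := hN x hxN
    have hmem : p ∈ MvPolynomial.vanishingIdeal ℂ N := by
      rw [MvPolynomial.mem_vanishingIdeal_iff]
      intro z hz
      simpa [hp] using hδN z hz
    have hle : MvPolynomial.vanishingIdeal ℂ N ≤ RingHom.ker (MvPolynomial.eval x) := by
      rw [← hF]
      exact Ideal.span_le.mpr fun q hq => hx q hq
    exact hδx (hp x ▸ hle hmem)

end Polynomial

/-! ### Polynomial families of vectors -/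

section Vectors

variable {V : Type*} {D : ℕ}

/-- The matrix whose rows are the vectors of the configuration `x` at the vertices in `A`. -/
def rowMatrix (A : Finset V) (x : V × Fin D → ℂ) : Matrix A (Fin D) ℂ :=
  Matrix.of fun i k => x (i, k)

theorem exists_rowMatrix_mul_eq_one [DecidableEq V] {A : Finset V} {x : V × Fin D → ℂ}
    (h : LinearIndependent ℂ (fun i : A => fun k => x ((i : V), k))) :
    ∃ R : Matrix (Fin D) A ℂ, rowMatrix A x * R = 1 := by
  rw [← Matrix.mulVec_surjective_iff_exists_right_inverse]
  have h1 : (rowMatrix A x).rank = Fintype.card A := LinearIndependent.rank_matrix h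
  have h2 : LinearMap.range (rowMatrix A x).mulVecLin = ⊤ := by
    apply Submodule.eq_top_of_finrank_eq
    rw [Module.finrank_fintype_fun_eq_card]
    exact h1
  exact LinearMap.range_eq_top.mp h2

theorem isPolyFun_rowMatrix_mul {A : Finset V} (R : Matrix (Fin D) A ℂ) (i j : A) :
    IsPolyFun (fun z : V × Fin D → ℂ => (rowMatrix A z * R :) i j) := by
  simp only [Matrix.mul_apply]
  exact IsPolyFun.sum _ fun k _ => (IsPolyFun.coord _).mul (IsPolyFun.const _)

/-- Linear independence is a Zariski open condition. -/
theorem linearIndependent_isOpen {A : Finset V} {x : V × Fin D → ℂ}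
    (h : LinearIndependent ℂ (fun i : A => fun k => x ((i : V), k))) :
    ∃ δ : (V × Fin D → ℂ) → ℂ, IsPolyFun δ ∧ δ x ≠ 0 ∧
      ∀ z, δ z ≠ 0 → LinearIndependent ℂ (fun i : A => fun k => z ((i : V), k)) := by
  classical
  obtain ⟨R, hR⟩ := exists_rowMatrix_mul_eq_one h
  refine ⟨fun z => (rowMatrix A z * R).det, IsPolyFun.det (isPolyFun_rowMatrix_mul R),
    by simp [hR], fun z hz => ?_⟩
  have h1 : Function.Injective (rowMatrix A z * R).vecMul :=
    Matrix.vecMul_injective_iff_isUnit.mpr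
      ((Matrix.isUnit_iff_isUnit_det _).mpr (isUnit_iff_ne_zero.mpr hz))
  refine (Matrix.vecMul_injective_iff (M := rowMatrix A z)).mp fun u w huw => h1 ?_
  simp only [← Matrix.vecMul_vecMul]
  exact congrArg (fun v => Matrix.vecMul v R) huw

/-- A vector `w` orthogonal to a linearly independent family extends to a polynomial family of
vectors `s z` orthogonal to `z i` for `i ∈ A`. With `M z` the matrix of rows `z i`, `R` a right
inverse of `M x` and `K z = M z * R`, the family is
`s z = det (K z) • w - R * adjugate (K z) * M z * w`. -/
theorem exists_orthogonal_section {A : Finset V} {x : V × Fin D → ℂ}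
    (h : LinearIndependent ℂ (fun i : A => fun k => x ((i : V), k))) {w : Fin D → ℂ}
    (hw : ∀ i ∈ A, ∑ k, x (i, k) * w k = 0) :
    ∃ s : (V × Fin D → ℂ) → Fin D → ℂ, (∀ k, IsPolyFun (fun z => s z k)) ∧ s x = w ∧
      ∀ z, ∀ i ∈ A, ∑ k, z (i, k) * s z k = 0 := by
  classical
  obtain ⟨R, hR⟩ := exists_rowMatrix_mul_eq_one h
  refine ⟨fun z => (rowMatrix A z * R).det • w -
    R.mulVec ((rowMatrix A z * R).adjugate.mulVec ((rowMatrix A z).mulVec w)), ?_, ?_, ?_⟩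
  · intro k
    simp only [Pi.sub_apply, Pi.smul_apply, smul_eq_mul]
    refine ((IsPolyFun.det (isPolyFun_rowMatrix_mul R)).mul (.const _)).sub ?_
    simp only [Matrix.mulVec, dotProduct]
    exact .sum _ fun i _ => (IsPolyFun.const _).mul (.sum _ fun j _ =>
      (IsPolyFun.adjugate (isPolyFun_rowMatrix_mul R) _ _).mul
        (.sum _ fun l _ => (IsPolyFun.coord _).mul (.const _)))
  · have h0 : (rowMatrix A x).mulVec w = 0 := funext fun i => hw i i.2
    simp [hR, h0]
  · intro z i hi
    have h1 : (rowMatrix A z).mulVec ((rowMatrix A z * R).det • w -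
        R.mulVec ((rowMatrix A z * R).adjugate.mulVec ((rowMatrix A z).mulVec w))) = 0 := by
      rw [Matrix.mulVec_sub, Matrix.mulVec_smul, Matrix.mulVec_mulVec, Matrix.mulVec_mulVec,
        Matrix.mul_adjugate, Matrix.smul_mulVec, Matrix.one_mulVec, sub_self]
    exact congrFun h1 ⟨i, hi⟩

/-- The configuration `z` with its vector at `b` replaced by `w`. -/
def replace [DecidableEq V] (b : V) (w : Fin D → ℂ) (z : V × Fin D → ℂ) : V × Fin D → ℂ :=
  fun p => if p.1 = b then w p.2 else z p

theorem replace_self [DecidableEq V] (b : V) (w : Fin D → ℂ) (z : V × Fin D → ℂ) (k : Fin D) :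
    replace b w z (b, k) = w k := by simp [replace]

theorem replace_of_ne [DecidableEq V] {b i : V} (h : i ≠ b) (w : Fin D → ℂ)
    (z : V × Fin D → ℂ) (k : Fin D) : replace b w z (i, k) = z (i, k) := by simp [replace, h]

theorem replace_eq_self [DecidableEq V] (b : V) (z : V × Fin D → ℂ) :
    replace b (fun k => z (b, k)) z = z := by
  ext ⟨i, k⟩
  by_cases h : i = b
  · subst h; rw [replace_self]
  · rw [replace_of_ne h]

theorem IsPolyFun.replace [DecidableEq V] {τ : Type*} (b : V) {s : (τ → ℂ) → Fin D → ℂ}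
    (hs : ∀ k, IsPolyFun (fun z => s z k)) {F : (τ → ℂ) → V × Fin D → ℂ}
    (hF : ∀ p, IsPolyFun (fun z => F z p)) (p : V × Fin D) :
    IsPolyFun (fun z => OrthRep.replace b (s z) (F z) p) := by
  by_cases h : p.1 = b
  · simpa [OrthRep.replace, h] using hs p.2
  · simpa [OrthRep.replace, h] using hF p

end Vectors

/-! ### Representations of an induced subgraph -/

section Partial

variable {V : Type*} {D : ℕ} (G : SimpleGraph V)

/-- The vectors of `x` at the vertices in `S` form an orthogonal representation of `G[S]`; the
vectors at the other vertices are unconstrained. -/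
def CorOn (S : Finset V) (x : V × Fin D → ℂ) : Prop :=
  ∀ i ∈ S, ∀ j ∈ S, i ≠ j → ¬ G.Adj i j → ∑ k, x (i, k) * x (j, k) = 0

/-- The vectors of `x` at any at most `D` of the vertices in `S` are linearly independent. -/
def GPOn (S : Finset V) (x : V × Fin D → ℂ) : Prop :=
  ∀ T ⊆ S, T.card ≤ D → LinearIndependent ℂ (fun i : T => fun k => x ((i : V), k))

/-- The configurations whose vectors at `S` form a general position representation of `G[S]`. -/
def partialCgorSet (D : ℕ) (S : Finset V) : Set (V × Fin D → ℂ) :=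
  {x | CorOn G S x ∧ GPOn S x}

/-- The configurations whose vectors at `S` form a representation of `G[S]`, in general position
away from the vertex `b`: the vector at `b`, chosen last, only has to be orthogonal to the vectors at
the non-neighbours of `b`. -/
def lastVertexSet [DecidableEq V] (D : ℕ) (S : Finset V) (b : V) : Set (V × Fin D → ℂ) :=
  {x | CorOn G S x ∧ GPOn (S.erase b) x}

variable {G}

theorem CorOn.mono {S T : Finset V} (h : T ⊆ S) {x : V × Fin D → ℂ} (hx : CorOn G S x) :
    CorOn G T x := fun i hi j hj => hx i (h hi) j (h hj)

theorem GPOn.mono {S T : Finset V} (h : T ⊆ S) {x : V × Fin D → ℂ} (hx : GPOn S x) :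
    GPOn T x := fun U hU => hx U (hU.trans h)

theorem CorOn.congr {S : Finset V} {x y : V × Fin D → ℂ} (h : ∀ i ∈ S, ∀ k, y (i, k) = x (i, k))
    (hx : CorOn G S x) : CorOn G S y := fun i hi j hj hij hadj => by
  rw [← hx i hi j hj hij hadj]
  exact Finset.sum_congr rfl fun k _ => by rw [h i hi, h j hj]

theorem GPOn.congr {S : Finset V} {x y : V × Fin D → ℂ} (h : ∀ i ∈ S, ∀ k, y (i, k) = x (i, k))
    (hx : GPOn S x) : GPOn S y := fun T hT hcard => by
  convert hx T hT hcard using 3 with i k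
  exact h i (hT i.2) _

theorem corOn_insert_iff [DecidableEq V] [DecidableRel G.Adj] {S : Finset V} {b : V} (hb : b ∉ S)
    {x : V × Fin D → ℂ} : CorOn G (insert b S) x ↔
      CorOn G S x ∧ ∀ i ∈ S.filter (fun i => ¬ G.Adj b i), ∑ k, x (i, k) * x (b, k) = 0 := by
  constructor
  · refine fun h => ⟨h.mono (Finset.subset_insert b S), fun i hi => ?_⟩
    rw [Finset.mem_filter] at hi
    exact h i (Finset.mem_insert_of_mem hi.1) b (Finset.mem_insert_self b S)
      (fun e => hb (e ▸ hi.1)) (fun e => hi.2 e.symm)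
  · rintro ⟨h1, h2⟩ i hi j hj hij hadj
    rcases Finset.mem_insert.mp hi with rfl | hiS <;> rcases Finset.mem_insert.mp hj with rfl | hjS
    · exact absurd rfl hij
    · rw [← h2 j (Finset.mem_filter.mpr ⟨hjS, hadj⟩)]
      exact Finset.sum_congr rfl fun k _ => mul_comm _ _
    · exact h2 i (Finset.mem_filter.mpr ⟨hiS, fun e => hadj e.symm⟩)
    · exact h1 i hiS j hjS hij hadj

theorem gpOn_isOpen {S : Finset V} {x : V × Fin D → ℂ} (hx : GPOn S x) :
    ∃ δ : (V × Fin D → ℂ) → ℂ, IsPolyFun δ ∧ δ x ≠ 0 ∧ ∀ z, δ z ≠ 0 → GPOn S z := by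
  classical
  have h : ∀ T ∈ S.powerset.filter (fun T => T.card ≤ D), ∃ δ : (V × Fin D → ℂ) → ℂ,
      IsPolyFun δ ∧ δ x ≠ 0 ∧
        ∀ z, δ z ≠ 0 → LinearIndependent ℂ (fun i : T => fun k => z ((i : V), k)) := by
    intro T hT
    rw [Finset.mem_filter, Finset.mem_powerset] at hT
    exact linearIndependent_isOpen (hx T hT.1 hT.2)
  choose! δ hδ hδx hδz using h
  refine ⟨fun z => ∏ T ∈ S.powerset.filter (fun T => T.card ≤ D), δ T z, IsPolyFun.prod _ hδ,
    Finset.prod_ne_zero_iff.mpr hδx, fun z hz T hT hcard => ?_⟩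
  have hmem : T ∈ S.powerset.filter (fun T => T.card ≤ D) := by
    rw [Finset.mem_filter, Finset.mem_powerset]
    exact ⟨hT, hcard⟩
  exact hδz T hmem z (Finset.prod_ne_zero_iff.mp hz T hmem)

/-- A polynomial function that is nonzero at a representation `x` of `G[S ∪ {b}]` is also nonzero
at `x` when evaluated along a suitable polynomial choice `s z` of the vector at `b` which, for every
`z`, is orthogonal to the vectors of `z` at the non-neighbours of `b`. -/
theorem exists_extension_section [DecidableEq V] [DecidableRel G.Adj]
    {S : Finset V} {b : V} (hb : b ∉ S)
    (hcard : (S.filter (fun i => ¬ G.Adj b i)).card ≤ D) {x : V × Fin D → ℂ}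
    (hx : CorOn G (insert b S) x) (hgp : GPOn S x) {f : (V × Fin D → ℂ) → ℂ} (hf : IsPolyFun f)
    (hfx : f x ≠ 0) :
    ∃ s : (V × Fin D → ℂ) → Fin D → ℂ,
      (∀ z, ∀ i ∈ S.filter (fun i => ¬ G.Adj b i), ∑ k, z (i, k) * s z k = 0) ∧
      IsPolyFun (fun z => f (replace b (s z) z)) ∧ f (replace b (s x) x) ≠ 0 := by
  obtain ⟨s, hs, hsx, hso⟩ := exists_orthogonal_section
    (hgp _ (Finset.filter_subset _ S) hcard) ((corOn_insert_iff hb).mp hx).2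
  refine ⟨s, hso, hf.comp (IsPolyFun.replace b hs fun p => IsPolyFun.coord p), ?_⟩
  rw [hsx, replace_eq_self]
  exact hfx

theorem corOn_insert_replace [DecidableEq V] [DecidableRel G.Adj]
    {S : Finset V} {b : V} (hb : b ∉ S) {z : V × Fin D → ℂ}
    (hz : CorOn G S z) {w : Fin D → ℂ}
    (hw : ∀ i ∈ S.filter (fun i => ¬ G.Adj b i), ∑ k, z (i, k) * w k = 0) :
    CorOn G (insert b S) (replace b w z) := by
  rw [corOn_insert_iff hb]
  refine ⟨hz.congr fun _ hi k => replace_of_ne (ne_of_mem_of_not_mem hi hb) w z k, fun i hi => ?_⟩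
  rw [← hw i hi]
  refine Finset.sum_congr rfl fun k _ => ?_
  rw [replace_self, replace_of_ne]
  rintro rfl
  exact hb (Finset.mem_filter.mp hi).1

theorem GPOn.replace [DecidableEq V] {S : Finset V} {b : V} (hb : b ∉ S) {z : V × Fin D → ℂ}
    (hz : GPOn S z) (w : Fin D → ℂ) : GPOn S (replace b w z) :=
  hz.congr fun _ hi k => replace_of_ne (ne_of_mem_of_not_mem hi hb) w z k

/-- Adding a last vertex keeps irreducibility: the vectors allowed at `b` form a linear space of
constant dimension, so the new set is a vector bundle over the old one. -/
theorem isPolyIrreducible_extension [DecidableEq V] [DecidableRel G.Adj]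
    {S : Finset V} {b : V} (hb : b ∉ S)
    (hcard : (S.filter (fun i => ¬ G.Adj b i)).card ≤ D)
    (hS : IsPolyIrreducible (partialCgorSet G D S)) :
    IsPolyIrreducible {x : V × Fin D → ℂ | CorOn G (insert b S) x ∧ GPOn S x} := by
  refine ⟨?_, ?_⟩
  · obtain ⟨x, hx, hgp⟩ := hS.1
    exact ⟨replace b 0 x, corOn_insert_replace hb hx (by simp), hgp.replace hb 0⟩
  · rintro f g hf hg ⟨x, ⟨hx, hxgp⟩, hfx⟩ ⟨y, ⟨hy, hygp⟩, hgy⟩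
    obtain ⟨s, hso, hsf, hsx⟩ := exists_extension_section hb hcard hx hxgp hf hfx
    obtain ⟨r, hro, hrg, hry⟩ := exists_extension_section hb hcard hy hygp hg hgy
    obtain ⟨z, ⟨hz, hzgp⟩, hz1, hz2⟩ := hS.2 _ _ hsf hrg
      ⟨x, ⟨hx.mono (Finset.subset_insert b S), hxgp⟩, hsx⟩
      ⟨y, ⟨hy.mono (Finset.subset_insert b S), hygp⟩, hry⟩
    -- Over the common base point `z`, move along the line joining the two vectors at `b`.
    obtain ⟨t, ht⟩ := hf.exists_line_ne_zero hg hz1 hz2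
    have hline : (fun p => replace b (s z) z p + t * (replace b (r z) z p - replace b (s z) z p)) =
        replace b (fun k => s z k + t * (r z k - s z k)) z := by
      ext ⟨i, k⟩
      by_cases h : i = b <;> simp [replace, h]
    rw [hline] at ht
    refine ⟨_, ⟨corOn_insert_replace hb hz fun i hi => ?_, hzgp.replace hb _⟩, ht⟩
    have h1 := hso z i hi
    have h2 := hro z i hi
    calc ∑ k, z (i, k) * (s z k + t * (r z k - s z k))
        = ∑ k, z (i, k) * s z k + t * (∑ k, z (i, k) * r z k - ∑ k, z (i, k) * s z k) := by
          rw [← Finset.sum_sub_distrib, Finset.mul_sum, ← Finset.sum_add_distrib]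
          exact Finset.sum_congr rfl fun k _ => by ring
      _ = 0 := by rw [h1, h2]; ring

/-- The vectors of two adjacent vertices can be chosen independently of each other, so some
representation is in general position both away from `a` and away from `b`. -/
theorem exists_gpOn_both [DecidableEq V] [DecidableRel G.Adj]
    {T : Finset V} {a b : V} (ha : a ∉ T) (hb : b ∉ T) (hab : G.Adj a b)
    (hca : (T.filter (fun i => ¬ G.Adj a i)).card ≤ D)
    (hcb : (T.filter (fun i => ¬ G.Adj b i)).card ≤ D)
    (hT : IsPolyIrreducible (partialCgorSet G D T))
    (hTa : (partialCgorSet G D (insert a T)).Nonempty)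
    (hTb : (partialCgorSet G D (insert b T)).Nonempty) :
    ∃ y : V × Fin D → ℂ, CorOn G (insert b (insert a T)) y ∧ GPOn (insert a T) y ∧
      GPOn (insert b T) y := by
  obtain ⟨x, hx, hxgp⟩ := hTa
  obtain ⟨y, hy, hygp⟩ := hTb
  have hTsa := Finset.subset_insert a T
  have hTsb := Finset.subset_insert b T
  obtain ⟨δ, hδ, hδx, hδz⟩ := gpOn_isOpen hxgp
  obtain ⟨ε, hε, hεy, hεz⟩ := gpOn_isOpen hygp
  obtain ⟨s, hso, hsδ, hsx⟩ := exists_extension_section ha hca hx (hxgp.mono hTsa) hδ hδx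
  obtain ⟨r, hro, hrε, hry⟩ := exists_extension_section hb hcb hy (hygp.mono hTsb) hε hεy
  obtain ⟨z, ⟨hz, -⟩, hz1, hz2⟩ := hT.2 _ _ hsδ hrε
    ⟨x, ⟨hx.mono hTsa, hxgp.mono hTsa⟩, hsx⟩ ⟨y, ⟨hy.mono hTsb, hygp.mono hTsb⟩, hry⟩
  have hba : b ∉ insert a T := by
    rw [Finset.mem_insert, not_or]
    exact ⟨hab.ne', hb⟩
  refine ⟨replace b (r z) (replace a (s z) z),
    corOn_insert_replace hba (corOn_insert_replace ha hz (hso z)) fun i hi => ?_,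
    (hδz _ hz1).replace hba _, (hεz _ hz2).congr fun i hi k => ?_⟩
  · have hia : i ≠ a := by
      rintro rfl
      exact (Finset.mem_filter.mp hi).2 hab.symm
    rw [Finset.filter_insert, if_neg (not_not.mpr hab.symm)] at hi
    rw [← hro z i hi]
    exact Finset.sum_congr rfl fun k _ => by rw [replace_of_ne hia]
  · by_cases hib : i = b
    · subst hib
      rw [replace_self, replace_self]
    · rw [replace_of_ne hib, replace_of_ne hib, replace_of_ne]
      rintro rfl
      exact ha ((Finset.mem_insert.mp hi).resolve_left hib)

/-- If the sets with last vertex `a` and last vertex `b` meet, each is open in the same irreducible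
closure, so a polynomial function that does not vanish on one does not vanish on the other. -/
theorem lastVertexSet_transfer [DecidableEq V] {S : Finset V} {a b : V}
    (ha : IsPolyIrreducible (lastVertexSet G D S a))
    (hmeet : (lastVertexSet G D S a ∩ lastVertexSet G D S b).Nonempty)
    {f : (V × Fin D → ℂ) → ℂ} (hf : IsPolyFun f) (hfa : ∃ x ∈ lastVertexSet G D S a, f x ≠ 0) :
    ∃ x ∈ lastVertexSet G D S b, f x ≠ 0 := by
  obtain ⟨y, hya, hyb⟩ := hmeet
  obtain ⟨δ, hδ, hδy, hδz⟩ := gpOn_isOpen hyb.2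
  obtain ⟨z, hz, hz1, hz2⟩ := ha.2 f δ hf hδ hfa ⟨y, hya, hδy⟩
  exact ⟨z, ⟨hz.1, hδz z hz2⟩, hz1⟩

/-- For at most `D` vertices, distinct standard basis vectors give a representation of any graph. -/
theorem partialCgorSet_nonempty_of_card_le {S : Finset V} (hS : S.card ≤ D) :
    (partialCgorSet G D S).Nonempty := by
  classical
  obtain ⟨e⟩ : Nonempty (S ↪ Fin D) :=
    Function.Embedding.nonempty_of_card_le (by simpa using hS)
  let x : V × Fin D → ℂ := fun p =>
    if h : p.1 ∈ S then (Pi.single (e ⟨p.1, h⟩) 1 : Fin D → ℂ) p.2 else 0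
  have hx : ∀ i (h : i ∈ S), (fun k => x (i, k)) = Pi.single (e ⟨i, h⟩) 1 := by
    intro i h
    ext k
    simp [x, h]
  refine ⟨x, fun i hi j hj hij _ => ?_, fun T hT _ => ?_⟩
  · have h1 : ∀ k, x (i, k) = (Pi.single (e ⟨i, hi⟩) 1 : Fin D → ℂ) k := congrFun (hx i hi)
    have h2 : ∀ k, x (j, k) = (Pi.single (e ⟨j, hj⟩) 1 : Fin D → ℂ) k := congrFun (hx j hj)
    simp only [h1, h2]
    simp [Pi.single_apply, hij.symm]
  · have h1 : (fun i : T => fun k => x ((i : V), k)) =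
        (fun k : Fin D => (Pi.single k 1 : Fin D → ℂ)) ∘ fun i : T => e ⟨i, hT i.2⟩ :=
      funext fun i => hx i (hT i.2)
    rw [h1]
    refine (Pi.linearIndependent_single_one (Fin D) ℂ).comp _ fun i j hij => ?_
    have := e.injective hij
    exact Subtype.ext (by simpa using this)

/-- A connected induced subgraph on more than `D` vertices has a general position representation
if all its proper induced subgraphs have an irreducible set of such representations. -/
theorem partialCgorSet_nonempty_of_connected [DecidableEq V] [DecidableRel G.Adj]
    {S : Finset V} (hS : D < S.card)
    (hdeg : ∀ b, ((S.erase b).filter (fun i => ¬ G.Adj b i)).card ≤ D)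
    (hconn : (G.induce {v | v ∈ S}).Preconnected)
    (ih : ∀ T ⊂ S, IsPolyIrreducible (partialCgorSet G D T)) :
    (partialCgorSet G D S).Nonempty := by
  have hirr : ∀ b ∈ S, IsPolyIrreducible (lastVertexSet G D S b) := by
    intro b hb
    have := isPolyIrreducible_extension (Finset.notMem_erase b S) (hdeg b)
      (ih _ (Finset.erase_ssubset hb))
    rwa [Finset.insert_erase hb] at this
  have hmeet : ∀ a ∈ S, ∀ b ∈ S, G.Adj a b →
      (lastVertexSet G D S a ∩ lastVertexSet G D S b).Nonempty := by
    intro a ha b hb hab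
    have hba : b ∈ S.erase a := Finset.mem_erase.mpr ⟨hab.ne', hb⟩
    have hab' : a ∈ S.erase b := Finset.mem_erase.mpr ⟨hab.ne, ha⟩
    have e1 : insert a ((S.erase a).erase b) = S.erase b := by
      rw [Finset.erase_right_comm, Finset.insert_erase hab']
    have e2 : insert b ((S.erase a).erase b) = S.erase a := Finset.insert_erase hba
    have hc : ∀ c, (((S.erase a).erase b) ⊆ S.erase c) →
        (((S.erase a).erase b).filter (fun i => ¬ G.Adj c i)).card ≤ D := fun c hc =>
      (Finset.card_le_card (Finset.filter_subset_filter _ hc)).trans (hdeg c)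
    obtain ⟨y, hy, hya, hyb⟩ := exists_gpOn_both (T := (S.erase a).erase b) (by simp) (by simp) hab
      (hc a (Finset.erase_subset _ _)) (hc b (Finset.erase_subset_erase _ (Finset.erase_subset _ _)))
      (ih _ ((Finset.erase_subset _ _).trans_ssubset (Finset.erase_ssubset ha)))
      (by rw [e1]; exact (ih _ (Finset.erase_ssubset hb)).1)
      (by rw [e2]; exact (ih _ (Finset.erase_ssubset ha)).1)
    rw [e1] at hy hya
    rw [e2] at hyb
    rw [Finset.insert_erase hb] at hy
    exact ⟨y, ⟨hy, hyb⟩, ⟨hy, hya⟩⟩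
  -- By connectivity all the sets with a prescribed last vertex have the same closure.
  have hall : ∀ f : (V × Fin D → ℂ) → ℂ, IsPolyFun f → ∀ a b : {v | v ∈ S},
      (∃ x ∈ lastVertexSet G D S a, f x ≠ 0) → ∃ x ∈ lastVertexSet G D S b, f x ≠ 0 := by
    intro f hf a b
    obtain ⟨w⟩ := hconn a b
    induction w with
    | nil => exact id
    | @cons u v w huv _ ihw =>
      exact fun h => ihw (lastVertexSet_transfer (hirr u u.2) (hmeet u u.2 v v.2 huv) hf h)
  obtain ⟨b₀, hb₀⟩ : S.Nonempty := Finset.card_pos.mp (by omega)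
  have h : ∀ T ∈ S.powerset.filter (fun T => T.card ≤ D), ∃ δ : (V × Fin D → ℂ) → ℂ,
      IsPolyFun δ ∧ (∃ x ∈ lastVertexSet G D S b₀, δ x ≠ 0) ∧
        ∀ z, δ z ≠ 0 → LinearIndependent ℂ (fun i : T => fun k => z ((i : V), k)) := by
    intro T hT
    rw [Finset.mem_filter, Finset.mem_powerset] at hT
    obtain ⟨b, hb, hbT⟩ := Finset.exists_mem_notMem_of_card_lt_card (hT.2.trans_lt hS)
    obtain ⟨x, hx⟩ := (hirr b hb).1
    obtain ⟨δ, hδ, hδx, hδz⟩ := linearIndependent_isOpen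
      (hx.2 T (Finset.subset_erase.mpr ⟨hT.1, hbT⟩) hT.2)
    exact ⟨δ, hδ, hall δ hδ ⟨b, hb⟩ ⟨b₀, hb₀⟩ ⟨x, hx, hδx⟩, hδz⟩
  choose! δ hδ hδx hδz using h
  obtain ⟨z, hz, hzδ⟩ := (hirr b₀ hb₀).exists_forall_ne_zero _ hδ hδx
  refine ⟨z, hz.1, fun T hT hcard => ?_⟩
  have hmem : T ∈ S.powerset.filter (fun T => T.card ≤ D) := by
    rw [Finset.mem_filter, Finset.mem_powerset]
    exact ⟨hT, hcard⟩
  exact hδz T hmem z (hzδ T hmem)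

theorem isPolyIrreducible_partialCgorSet [DecidableEq V] [DecidableRel G.Adj]
   
    (hdeg : ∀ (S : Finset V) (b : V), ((S.erase b).filter (fun i => ¬ G.Adj b i)).card ≤ D)
    (hconn : ∀ S : Finset V, D < S.card → (G.induce {v | v ∈ S}).Preconnected) (S : Finset V) :
    IsPolyIrreducible (partialCgorSet G D S) := by
  induction S using Finset.strongInduction with
  | H S ih =>
    have hne : (partialCgorSet G D S).Nonempty := by
      rcases le_or_gt S.card D with h | h
      · exact partialCgorSet_nonempty_of_card_le h
      · exact partialCgorSet_nonempty_of_connected h (hdeg S) (hconn S h) ih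
    rcases S.eq_empty_or_nonempty with rfl | ⟨b, hb⟩
    · refine IsPolyIrreducible.univ.of_isOpen (Set.subset_univ _) hne fun x hx =>
        ⟨fun _ => 1, .const 1, one_ne_zero, fun z _ _ => ?_⟩
      exact ⟨hx.1.congr (by simp), hx.2.congr (by simp)⟩
    · have := isPolyIrreducible_extension (Finset.notMem_erase b S) (hdeg S b)
        (ih _ (Finset.erase_ssubset hb))
      rw [Finset.insert_erase hb] at this
      refine this.of_isOpen (fun x hx => ⟨hx.1, hx.2.mono (Finset.erase_subset b S)⟩) hne
        fun x hx => ?_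
      obtain ⟨δ, hδ, hδx, hδz⟩ := gpOn_isOpen hx.2
      exact ⟨δ, hδ, hδx, fun z hz h => ⟨hz.1, hδz z h⟩⟩

end Partial

/-! ### Connectivity and the non-neighbours of a vertex -/

section Connectivity

variable {V : Type*} [Fintype V] {G : SimpleGraph V} {D : ℕ}

theorem IsKConnected.card_nonNeighbors_le [DecidableEq V] [DecidableRel G.Adj]
    (h : IsKConnected G (Fintype.card V - D)) (b : V) :
    ((Finset.univ.erase b).filter (fun i => ¬ G.Adj b i)).card ≤ D := by
  by_contra! hlt
  have hcard : (G.neighborFinset b).card +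
      ((Finset.univ.erase b).filter (fun i => ¬ G.Adj b i)).card ≤ Fintype.card V := by
    rw [← Finset.card_union_of_disjoint]
    · exact Finset.card_le_univ _
    · rw [Finset.disjoint_left]
      intro i hi hi'
      exact (Finset.mem_filter.mp hi').2 ((G.mem_neighborFinset b i).mp hi)
  -- Deleting all neighbours of `b` isolates `b` from its non-neighbours.
  have hconn := h.2 (G.neighborFinset b) (by omega)
  obtain ⟨i, hi⟩ := Finset.card_pos.mp ((Nat.zero_le D).trans_lt hlt)
  rw [Finset.mem_filter, Finset.mem_erase] at hi
  obtain ⟨w⟩ := hconn.preconnected ⟨b, by simp⟩ ⟨i, by simpa using hi.2⟩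
  cases w with
  | nil => exact hi.1.1 rfl
  | @cons _ c _ hbc _ => exact c.2 ((G.mem_neighborFinset b c).mpr hbc)

theorem IsKConnected.preconnected_induce (h : IsKConnected G (Fintype.card V - D))
    {S : Finset V} (hS : D < S.card) : (G.induce {v | v ∈ S}).Preconnected := by
  classical
  have hc := Finset.card_add_card_compl S
  have h1 := (h.2 Sᶜ (by omega)).preconnected
  have h2 : {v | v ∉ Sᶜ} = {v | v ∈ S} := by ext; simp
  rwa [h2] at h1

/-- Mutually orthogonal linearly independent families in `ℂ^D` have at most `D` members in total.
The dot product is non-degenerate, so isotropic vectors do no harm. -/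
theorem card_add_card_le_of_orthogonal {ι κ : Type*} [Fintype ι] [Fintype κ] {v : ι → Fin D → ℂ}
    {w : κ → Fin D → ℂ} (hv : LinearIndependent ℂ v) (hw : LinearIndependent ℂ w)
    (h : ∀ i j, ∑ k, v i k * w j k = 0) : Fintype.card ι + Fintype.card κ ≤ D := by
  have h1 : (Matrix.of v : Matrix ι (Fin D) ℂ).rank = Fintype.card ι := hv.rank_matrix
  have h2 : (Matrix.of w : Matrix κ (Fin D) ℂ).transpose.rank = Fintype.card κ := by
    rw [Matrix.rank_transpose]
    exact LinearIndependent.rank_matrix hw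
  have h3 : (Matrix.of v : Matrix ι (Fin D) ℂ) * (Matrix.of w : Matrix κ (Fin D) ℂ).transpose = 0 :=
    Matrix.ext h
  have := Matrix.rank_add_rank_le_card_of_mul_eq_zero h3
  rwa [h1, h2, Fintype.card_fin] at this

/-- The two sides of a separation are independent, since each consists of non-neighbours of a vertex
on the other side, and they are mutually orthogonal. So they have at most `D` vertices. -/
theorem isKConnected_of_nonNeighborsIndependent (hD : 1 ≤ D) (hn : D < Fintype.card V)
    {v : V → Fin D → ℂ} (hv : IsCOR G v) (hind : NonNeighborsIndependent G v) :
    IsKConnected G (Fintype.card V - D) := by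
  classical
  refine ⟨by omega, fun S hS => ?_⟩
  have hcompl := Finset.card_add_card_compl S
  obtain ⟨c, hc⟩ : Sᶜ.Nonempty := Finset.card_pos.mp (by omega)
  rw [Finset.mem_compl] at hc
  have : Nonempty {v | v ∉ S} := ⟨⟨c, hc⟩⟩
  refine ⟨fun u w => ?_⟩
  by_contra huw
  let r : {v | v ∉ S} → Prop := fun z => (G.induce {v | v ∉ S}).Reachable u z
  have hadj : ∀ a b : {v | v ∉ S}, r a → ¬ r b → a.1 ≠ b.1 ∧ ¬ G.Adj a.1 b.1 := by
    refine fun a b ha hb => ⟨fun h => hb (Subtype.ext h ▸ ha), fun h => hb ?_⟩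
    exact ha.trans (SimpleGraph.Adj.reachable (show (G.induce {v | v ∉ S}).Adj a b from h))
  have hA : LinearIndependent ℂ (fun a : {a // r a} => v a.1.1) :=
    (hind w.1).comp (fun a : {a // r a} => ⟨a.1.1, (hadj a.1 w a.2 huw).1,
      fun h => (hadj a.1 w a.2 huw).2 h.symm⟩) fun a b hab =>
        Subtype.ext (Subtype.ext (by simpa using hab))
  have hu : r u := SimpleGraph.Reachable.refl u
  have hB : LinearIndependent ℂ (fun b : {b // ¬ r b} => v b.1.1) :=
    (hind u.1).comp (fun b : {b // ¬ r b} => ⟨b.1.1, (hadj u b.1 hu b.2).1.symm,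
      (hadj u b.1 hu b.2).2⟩) fun a b hab =>
        Subtype.ext (Subtype.ext (by simpa using hab))
  have hle := card_add_card_le_of_orthogonal hA hB fun a b =>
    hv _ _ (hadj a.1 b.1 a.2 b.2).1 (hadj a.1 b.1 a.2 b.2).2
  have hsum := Fintype.card_subtype_compl r
  have hle' := Fintype.card_subtype_le r
  have hcard : Fintype.card {v | v ∉ S} = Sᶜ.card := by
    rw [Fintype.card_subtype]
    congr 1
    ext
    simp
  omega

/-- In a general position representation a vertex has at most `D` non-neighbours: otherwise its
vector would be orthogonal to a basis of `ℂ^D`, hence zero. -/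
theorem IsCGOR.nonNeighborsIndependent (hD : 1 ≤ D) {v : V → Fin D → ℂ} (hv : IsCGOR G v) :
    NonNeighborsIndependent G v := by
  classical
  intro i
  let A : Finset V := Finset.univ.filter fun j => j ≠ i ∧ ¬ G.Adj i j
  have hA : ∀ j, j ∈ A ↔ j ≠ i ∧ ¬ G.Adj i j := by simp [A]
  have hcard : A.card ≤ D := by
    by_contra! hlt
    obtain ⟨T, hTA, hT⟩ := Finset.exists_subset_card_eq hlt.le
    have hi : LinearIndependent ℂ (fun j : ({i} : Finset V) => v j) := hv.2 {i} (by simpa using hD)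
    have := card_add_card_le_of_orthogonal hi (hv.2 T hT.le) fun a b => by
      have ha : a.1 = i := Finset.mem_singleton.mp a.2
      have hb := (hA b).mp (hTA b.2)
      rw [ha]
      exact hv.1 i b hb.1.symm hb.2
    simp [hT] at this
  exact (hv.2 A hcard).comp (fun j : {j // j ≠ i ∧ ¬ G.Adj i j} => ⟨j.1, (hA j.1).mpr j.2⟩)
    fun a b hab => Subtype.ext (by simpa using hab)

theorem partialCgorSet_univ : partialCgorSet G D Finset.univ = cgorSet G D := by
  ext x
  refine and_congr ⟨fun h i j => h i (Finset.mem_univ i) j (Finset.mem_univ j),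
    fun h i _ j _ => h i j⟩ ⟨fun h T => h T (Finset.subset_univ T), fun h T _ => h T⟩

theorem isQuasiProjective_cgorSet : IsQuasiProjective (cgorSet G D) := by
  classical
  refine ⟨{x | CorOn G Finset.univ x}, {x | ¬ GPOn Finset.univ x},
    isAlgebraicSet_of_isOpen_compl fun x hx => ?_, isAlgebraicSet_of_isOpen_compl fun x hx => ?_, ?_⟩
  · simp only [Set.mem_ofPred_eq, CorOn, not_forall] at hx
    obtain ⟨i, hi, j, hj, hij, hadj, hne⟩ := hx
    exact ⟨fun z => ∑ k, z (i, k) * z (j, k),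
      .sum _ fun k _ => (IsPolyFun.coord _).mul (.coord _), hne,
      fun z hz => hz i hi j hj hij hadj⟩
  · obtain ⟨δ, hδ, hδx, hδz⟩ := gpOn_isOpen (not_not.mp hx)
    exact ⟨δ, hδ, hδx, fun z hz => by_contra fun h => hz (hδz z h)⟩
  · rw [← partialCgorSet_univ]
    ext x
    simp [partialCgorSet]

end Connectivity

end OrthRep

theorem mainTheorem8 {V : Type*} [Fintype V] (G : SimpleGraph V) (D : ℕ) (hD : 1 ≤ D)
    (hn : D < Fintype.card V) :
    (OrthRep.IsKConnected G (Fintype.card V - D) →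
      (OrthRep.cgorSet G D).Nonempty ∧
      OrthRep.IsQuasiProjective (OrthRep.cgorSet G D) ∧
      OrthRep.IsIrreducibleSet (OrthRep.cgorSet G D)) ∧
    (¬ OrthRep.IsKConnected G (Fintype.card V - D) →
      (¬ ∃ v : V → Fin D → ℂ, OrthRep.IsCGOR G v) ∧
      (¬ ∃ v : V → Fin D → ℂ, OrthRep.IsCOR G v ∧ OrthRep.NonNeighborsIndependent G v)) := by
  classical
  refine ⟨fun h => ?_, fun h => ⟨?_, ?_⟩⟩
  · have hirr := OrthRep.isPolyIrreducible_partialCgorSet (G := G) (D := D)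
      (fun S b => (Finset.card_le_card (Finset.filter_subset_filter _
        (Finset.erase_subset_erase b (Finset.subset_univ S)))).trans (h.card_nonNeighbors_le b))
      (fun S hS => h.preconnected_induce hS) Finset.univ
    rw [OrthRep.partialCgorSet_univ] at hirr
    exact ⟨hirr.1, OrthRep.isQuasiProjective_cgorSet, hirr.isIrreducibleSet⟩
  · rintro ⟨v, hv⟩
    exact h (OrthRep.isKConnected_of_nonNeighborsIndependent hD hn hv.1
      (hv.nonNeighborsIndependent hD))
  · rintro ⟨v, hv, hind⟩
    exact h (OrthRep.isKConnected_of_nonNeighborsIndependent hD hn hv hind)
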